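/- Let $(c_n)_{n\ge 1}$ be an unbounded increasing sequence of real numbers with $c_n>1$ for all $n$. Let $d_n\in M_n=M_n(\mathbb C)$ be the diagonal matrix whose $k$th diagonal entry is $c_n^k$ ($1\le k\le n$). Let $M=\oplus^\infty_n (M_n\oplus M_n)$ be the von Neumann algebra of bounded sequences, and let $N$ be its subalgebra consisting of all tuples $((x_n, d_nx_nd_n^{-1}))_n$ in $M$; such a tuple is also written $(x_n)$, and $p$ denotes the norm of $N$. Let $L_n$ be the left shift on $\mathbb C^n$ ($L_ne_1=0$, $L_ne_{j+1}=e_j$). For $k\le n$ put $E_{n,k}=\{i\in\mathbb Z : \frac nk\le i\le\frac{2n}{k}\}$ and $u_{n,k}=\frac1{|E_{n,k}|}\sum_{i\in E_{n,k}}L_n^i$; for $k>n$ put $u_{n,k}=I_n$. Let $u_k=(u_{n,k})_n\in N$ for $k \geq 1$, and define the (in general non-unital) algebra $$A=\{a\in N:\ p(au_k-a)+p(u_ka-a)\to 0 \text{ as } k\to\infty\}.$$ A left (right) ideal $J$ of $A$ is a linear subspace with $AJ\subseteq J$ ($JA\subseteq J$); it is modular if there is $u\in A$ with $a-au\in J$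 (resp. $a-ua\in J$) for all $a\in A$. A maximal modular left (right) ideal is a maximal element among the proper modular left (right) ideals. A minimal idempotent of a complex algebra $B$ is an idempotent $e\ne0$ with $eBe=\mathbb Ce$. The canonical copy of $x\in M_n$ in $A$ is the tuple with $n$th entry $(x,d_nxd_n^{-1})$ and all other entries $0$. Then the maximal modular right (resp. left) ideals of $A$ are exactly the sets $$(1-e)A=\{a-ea: a\in A\}\qquad(\text{resp. } A(1-e)=\{a-ae : a\in A\}),$$ where $e$ is a minimal idempotent of $A$ which is the canonical copy in $A$ of a minimal idempotent of $M_n$ for some $n\ge 1$. Moreover, the socle of $A$ is the set $A_{00}$ of all finitely supported tuples in $N$: both the sum of all minimal left ideals of $A$ and the sum of all minimal right ideals of $A$ are equal to $A_{00}$. -/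

import Mathlib

open Filter Topology
open scoped ENNReal Matrix.Norms.L2Operator

noncomputable section

/-! ### Ideals and idempotents in a (possibly non-unital) complex algebra -/

section General

variable {A : Type*} [NonUnitalRing A] [Module ℂ A]

/-- A left ideal of the algebra `A`: a linear subspace `J` with `A J ⊆ J`. -/
def IsLeftIdeal (J : Submodule ℂ A) : Prop := ∀ a : A, ∀ x ∈ J, a * x ∈ J

/-- A right ideal of the algebra `A`: a linear subspace `J` with `J A ⊆ J`. -/
def IsRightIdeal (J : Submodule ℂ A) : Prop := ∀ a : A, ∀ x ∈ J, x * a ∈ J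

/-- A left ideal `J` is modular if there is `u` with `A (1 - u) ⊆ J`. -/
def IsModularLeftIdeal (J : Submodule ℂ A) : Prop :=
  IsLeftIdeal J ∧ ∃ u : A, ∀ a : A, a - a * u ∈ J

/-- A right ideal `J` is modular if there is `u` with `(1 - u) A ⊆ J`. -/
def IsModularRightIdeal (J : Submodule ℂ A) : Prop :=
  IsRightIdeal J ∧ ∃ u : A, ∀ a : A, a - u * a ∈ J

/-- Maximal modular left ideals: maximal elements among the proper modular left ideals. -/
def IsMaximalModularLeftIdeal (J : Submodule ℂ A) : Prop :=
  Maximal (fun K : Submodule ℂ A => IsModularLeftIdeal K ∧ K ≠ ⊤) J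

/-- Maximal modular right ideals: maximal elements among the proper modular right ideals. -/
def IsMaximalModularRightIdeal (J : Submodule ℂ A) : Prop :=
  Maximal (fun K : Submodule ℂ A => IsModularRightIdeal K ∧ K ≠ ⊤) J

/-- Minimal left ideals: minimal elements among the nonzero left ideals. -/
def IsMinimalLeftIdeal (J : Submodule ℂ A) : Prop :=
  Minimal (fun K : Submodule ℂ A => IsLeftIdeal K ∧ K ≠ ⊥) J

/-- Minimal right ideals: minimal elements among the nonzero right ideals. -/
def IsMinimalRightIdeal (J : Submodule ℂ A) : Prop :=
  Minimal (fun K : Submodule ℂ A => IsRightIdeal K ∧ K ≠ ⊥) J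

variable (A) in
/-- The left socle: the sum of all minimal left ideals. -/
def leftSocle : Submodule ℂ A := sSup {J | IsMinimalLeftIdeal J}

variable (A) in
/-- The right socle: the sum of all minimal right ideals. -/
def rightSocle : Submodule ℂ A := sSup {J | IsMinimalRightIdeal J}

/-- A minimal idempotent: a nonzero idempotent `e` with `e A e = ℂ e`. -/
def IsMinimalIdempotent (e : A) : Prop :=
  e ≠ 0 ∧ e * e = e ∧ Set.range (fun a : A => e * a * e) = Set.range (fun z : ℂ => z • e)

end General

/-! ### The example -/

/-- The C*-algebra `M_n` of complex `n × n` matrices, with the operator norm. -/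
abbrev Mat (n : ℕ+) : Type := Matrix (Fin n) (Fin n) ℂ

/-- The von Neumann algebra `M = ⊕^∞_n (M_n ⊕ M_n)` of bounded sequences, with the supremum norm. -/
abbrev BigM : Type := lp (fun n : ℕ+ => Mat n × Mat n) ∞

instance : NonUnitalNormedRing BigM := lp.nonUnitalNormedRing

instance : NonUnitalRing BigM := lp.nonUnitalRing

instance : Module ℂ BigM := inferInstance

/-- The diagonal matrix `d_n`, whose `k`-th diagonal entry (`k = 1, …, n`) is `c_n ^ k`. -/
def dMat (c : ℕ+ → ℝ) (n : ℕ+) : Mat n :=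
  Matrix.diagonal fun i => ((c n : ℂ) ^ ((i : ℕ) + 1))

/-- The pair `(x, d_n x d_n⁻¹)`. -/
def twist (c : ℕ+ → ℝ) (n : ℕ+) (x : Mat n) : Mat n × Mat n :=
  (x, dMat c n * x * (dMat c n)⁻¹)

/-- The left shift `L_n` on `ℂ^n`: `L_n e_1 = 0` and `L_n e_{j+1} = e_j`. -/
def shiftMat (n : ℕ+) : Mat n :=
  Matrix.of fun i j => if (j : ℕ) = (i : ℕ) + 1 then 1 else 0

/-- The integers in the interval `[n / k, 2 n / k]`. -/
def intInterval (n k : ℕ+) : Finset ℕ :=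
  Finset.Icc ⌈(n : ℚ) / (k : ℚ)⌉₊ ⌊2 * (n : ℚ) / (k : ℚ)⌋₊

/-- `u_{n,k}`: the average of the powers `L_n ^ i` over the integers `i` in `[n / k, 2 n / k]` if
`n ≥ k`, and the identity matrix if `n < k`. -/
def uMat (n k : ℕ+) : Mat n :=
  if k ≤ n then ((intInterval n k).card : ℂ)⁻¹ • ∑ i ∈ intInterval n k, shiftMat n ^ i else 1

section Helpers

variable {c : ℕ+ → ℝ}

theorem isUnit_det_dMat (hc : ∀ n, 1 < c n) (n : ℕ+) : IsUnit (dMat c n).det := by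
  rw [dMat, Matrix.det_diagonal, isUnit_iff_ne_zero, Finset.prod_ne_zero_iff]
  intro i _
  have : (c n : ℂ) ≠ 0 := by
    have := hc n
    exact_mod_cast (by linarith : c n ≠ 0)
  exact pow_ne_zero _ this

theorem twist_mul (hc : ∀ n, 1 < c n) (n : ℕ+) (x y : Mat n) :
    twist c n (x * y) = twist c n x * twist c n y := by
  have h := Matrix.nonsing_inv_mul (dMat c n) (isUnit_det_dMat hc n)
  simp only [twist, Prod.mk_mul_mk, Prod.mk.injEq, true_and]
  calc dMat c n * (x * y) * (dMat c n)⁻¹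
      = dMat c n * x * 1 * (y * (dMat c n)⁻¹) := by simp only [mul_one, mul_assoc]
    _ = _ := by rw [← h]; simp only [mul_assoc]

theorem twist_one (hc : ∀ n, 1 < c n) (n : ℕ+) : twist c n 1 = 1 := by
  simp [twist, Matrix.mul_nonsing_inv (dMat c n) (isUnit_det_dMat hc n), Prod.ext_iff]

theorem twist_add (n : ℕ+) (x y : Mat n) : twist c n (x + y) = twist c n x + twist c n y := by
  simp [twist, mul_add, add_mul]

theorem twist_zero (n : ℕ+) : twist c n 0 = 0 := by
  simp [twist]

theorem twist_smul (n : ℕ+) (z : ℂ) (x : Mat n) : twist c n (z • x) = z • twist c n x := by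
  simp [twist]

theorem twist_sum (n : ℕ+) (s : Finset ℕ) (f : ℕ → Mat n) :
    twist c n (∑ i ∈ s, f i) = ∑ i ∈ s, twist c n (f i) :=
  map_sum (⟨⟨twist c n, twist_zero n⟩, twist_add n⟩ : Mat n →+ Mat n × Mat n) f s

theorem twist_pow (hc : ∀ n, 1 < c n) (n : ℕ+) (x : Mat n) (i : ℕ) :
    twist c n (x ^ i) = twist c n x ^ i := by
  induction i with
  | zero => simp [twist_one hc]
  | succ i ih => rw [pow_succ, pow_succ, twist_mul hc, ih]

theorem norm_shiftMat_le (n : ℕ+) : ‖shiftMat n‖ ≤ 1 := by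
  have h : (shiftMat n).conjTranspose * shiftMat n =
      Matrix.diagonal fun j : Fin n => if (j : ℕ) = 0 then (0 : ℂ) else 1 := by
    ext i j
    rw [Matrix.mul_apply, Matrix.diagonal_apply]
    simp only [Matrix.conjTranspose_apply, shiftMat, Matrix.of_apply]
    by_cases hj : (j : ℕ) = 0
    · by_cases hij : i = j
      · subst hij; simp [hj]
      · simp [hj, hij]
    · have hjn := j.isLt
      rw [Finset.sum_eq_single (⟨(j : ℕ) - 1, by omega⟩ : Fin n)]
      · have h1 : (j : ℕ) = (j : ℕ) - 1 + 1 := by omega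
        by_cases hij : i = j
        · subst hij
          simp only [← h1]
          simp [hj]
        · have h2 : ¬ (i : ℕ) = (j : ℕ) - 1 + 1 := by
            intro h; exact hij (Fin.ext (by omega))
          simp [hij, h2]
      · intro b _ hb
        have : ¬ (j : ℕ) = (b : ℕ) + 1 := by
          intro h; exact hb (Fin.ext (by simp [h]))
        simp [this]
      · simp
  have h2 : ‖shiftMat n‖ * ‖shiftMat n‖ ≤ 1 := by
    rw [← Matrix.l2_opNorm_conjTranspose_mul_self, h, Matrix.l2_opNorm_diagonal,
      pi_norm_le_iff_of_nonneg zero_le_one]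
    intro j
    split_ifs <;> simp
  nlinarith [norm_nonneg (shiftMat n)]

theorem dMat_mul_shiftMat (hc : ∀ n, 1 < c n) (n : ℕ+) :
    dMat c n * shiftMat n * (dMat c n)⁻¹ = ((c n : ℂ)⁻¹) • shiftMat n := by
  have h0 : (c n : ℂ) ≠ 0 := by
    have := hc n
    exact_mod_cast (by linarith : c n ≠ 0)
  have h1 : dMat c n * shiftMat n = ((c n : ℂ)⁻¹) • shiftMat n * dMat c n := by
    ext i j
    simp only [dMat, Matrix.diagonal_mul, Matrix.mul_diagonal, Matrix.smul_apply, shiftMat,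
      Matrix.of_apply, smul_eq_mul]
    split_ifs with h
    · rw [h, pow_succ _ ((i : ℕ) + 1)]; field_simp
    · simp
  rw [h1, Matrix.mul_assoc, Matrix.mul_nonsing_inv _ (isUnit_det_dMat hc n), mul_one]

theorem norm_twist_shiftMat_le (hc : ∀ n, 1 < c n) (n : ℕ+) : ‖twist c n (shiftMat n)‖ ≤ 1 := by
  rw [Prod.norm_def]
  refine max_le (norm_shiftMat_le n) ?_
  simp only [twist]
  rw [dMat_mul_shiftMat hc, norm_smul, norm_inv, Complex.norm_real, Real.norm_eq_abs]
  have hn := hc n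
  have h1 : |c n|⁻¹ ≤ 1 := by
    rw [abs_of_pos (by linarith)]
    exact inv_le_one_of_one_le₀ hn.le
  calc |c n|⁻¹ * ‖shiftMat n‖ ≤ 1 * 1 :=
        mul_le_mul h1 (norm_shiftMat_le n) (norm_nonneg _) zero_le_one
    _ = 1 := one_mul 1

theorem norm_twist_uMat_le (hc : ∀ n, 1 < c n) (n k : ℕ+) : ‖twist c n (uMat n k)‖ ≤ 1 := by
  rw [uMat]
  split_ifs with h
  · rw [twist_smul, twist_sum, norm_smul, norm_inv, Complex.norm_natCast]
    have hs : ‖∑ i ∈ intInterval n k, twist c n (shiftMat n ^ i)‖ ≤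
        ((intInterval n k).card : ℝ) := by
      refine (norm_sum_le_of_le (f := fun i => twist c n (shiftMat n ^ i)) (n := fun _ => (1 : ℝ))
        _ fun i _ => ?_).trans (by simp)
      rw [twist_pow hc]
      exact (norm_pow_le _ i).trans (pow_le_one₀ (norm_nonneg _) (norm_twist_shiftMat_le hc n))
    calc ((intInterval n k).card : ℝ)⁻¹ * ‖∑ i ∈ intInterval n k, twist c n (shiftMat n ^ i)‖
        ≤ ((intInterval n k).card : ℝ)⁻¹ * ((intInterval n k).card : ℝ) :=
          mul_le_mul_of_nonneg_left hs (by positivity)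
      _ ≤ 1 := inv_mul_le_one
  · rw [twist_one hc, norm_one]

end Helpers

/-- The algebra `N` of all tuples `((x_n, d_n x_n d_n⁻¹))_n` in `M`. The norm `p` of `N` is the norm
inherited from `M`. -/
def algN (c : ℕ+ → ℝ) (hc : ∀ n, 1 < c n) : NonUnitalSubalgebra ℂ BigM where
  carrier := {a | ∀ n, ∃ x : Mat n, a n = twist c n x}
  add_mem' := by
    intro a b ha hb n
    obtain ⟨x, hx⟩ := ha n
    obtain ⟨y, hy⟩ := hb n
    exact ⟨x + y, by rw [twist_add, ← hx, ← hy]; rfl⟩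
  zero_mem' := fun n => ⟨0, by rw [twist_zero]; rfl⟩
  mul_mem' := by
    intro a b ha hb n
    obtain ⟨x, hx⟩ := ha n
    obtain ⟨y, hy⟩ := hb n
    exact ⟨x * y, by rw [twist_mul hc, ← hx, ← hy]; rfl⟩
  smul_mem' := by
    intro z a ha n
    obtain ⟨x, hx⟩ := ha n
    exact ⟨z • x, by rw [twist_smul, ← hx]; rfl⟩

/-- The element `u_k = (u_{n,k})_n` of `N`, that is, the tuple `((u_{n,k}, d_n u_{n,k} d_n⁻¹))_n`. -/
def uElt (c : ℕ+ → ℝ) (hc : ∀ n, 1 < c n) (k : ℕ+) : BigM :=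
  ⟨fun n => twist c n (uMat n k), memℓp_infty ⟨1, by
    rintro _ ⟨n, rfl⟩
    exact norm_twist_uMat_le hc n k⟩⟩

/-- The algebra `A = {a ∈ N : p(a u_k - a) + p(u_k a - a) → 0}`. -/
def algA (c : ℕ+ → ℝ) (hc : ∀ n, 1 < c n) : NonUnitalSubalgebra ℂ BigM where
  carrier := {a | a ∈ algN c hc ∧
    Tendsto (fun k => ‖a * uElt c hc k - a‖ + ‖uElt c hc k * a - a‖) atTop (𝓝 0)}
  add_mem' := by
    rintro a b ⟨ha, ha'⟩ ⟨hb, hb'⟩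
    refine ⟨add_mem ha hb, squeeze_zero (fun k => by positivity) (fun k => ?_)
      (by simpa using ha'.add hb')⟩
    have h1 : (a + b) * uElt c hc k - (a + b) =
        (a * uElt c hc k - a) + (b * uElt c hc k - b) := by rw [add_mul]; abel
    have h2 : uElt c hc k * (a + b) - (a + b) =
        (uElt c hc k * a - a) + (uElt c hc k * b - b) := by rw [mul_add]; abel
    rw [h1, h2]
    linarith [norm_add_le (a * uElt c hc k - a) (b * uElt c hc k - b),
      norm_add_le (uElt c hc k * a - a) (uElt c hc k * b - b)]
  zero_mem' := ⟨zero_mem _, by simp⟩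
  mul_mem' := by
    rintro a b ⟨ha, ha'⟩ ⟨hb, hb'⟩
    refine ⟨mul_mem ha hb, squeeze_zero (fun k => by positivity) (fun k => ?_)
      (by simpa using (hb'.const_mul ‖a‖).add (ha'.mul_const ‖b‖))⟩
    have h1 : a * b * uElt c hc k - a * b = a * (b * uElt c hc k - b) := by
      rw [mul_sub, mul_assoc]
    have h2 : uElt c hc k * (a * b) - a * b = (uElt c hc k * a - a) * b := by
      rw [sub_mul, mul_assoc]
    rw [h1, h2]
    have h3 := norm_mul_le a (b * uElt c hc k - b)
    have h4 := norm_mul_le (uElt c hc k * a - a) b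
    have h5 := mul_nonneg (norm_nonneg a) (norm_nonneg (uElt c hc k * b - b))
    have h6 := mul_nonneg (norm_nonneg (a * uElt c hc k - a)) (norm_nonneg b)
    linarith
  smul_mem' := by
    rintro z a ⟨ha, ha'⟩
    refine ⟨SMulMemClass.smul_mem z ha, squeeze_zero (fun k => by positivity) (fun k => ?_)
      (by simpa using ha'.const_mul ‖z‖)⟩
    rw [smul_mul_assoc, mul_smul_comm, ← smul_sub, ← smul_sub, norm_smul, norm_smul, mul_add]

/-- The underlying type of the algebra `A`, with its algebra structure. -/
def AlgA (c : ℕ+ → ℝ) (hc : ∀ n, 1 < c n) : Type := {a : BigM // a ∈ algA c hc}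

instance (c : ℕ+ → ℝ) (hc : ∀ n, 1 < c n) : NonUnitalRing (AlgA c hc) :=
  NonUnitalSubalgebra.toNonUnitalRing (algA c hc)

instance (c : ℕ+ → ℝ) (hc : ∀ n, 1 < c n) : Module ℂ (AlgA c hc) :=
  NonUnitalSubalgebra.instModule (S := algA c hc)

/-- The inclusion of `A` in `M`. -/
def AlgA.incl (c : ℕ+ → ℝ) (hc : ∀ n, 1 < c n) (a : AlgA c hc) : BigM := a.1

/-- `A_00`: the finitely supported tuples in `N`. -/
def finSupp (c : ℕ+ → ℝ) (hc : ∀ n, 1 < c n) : Set BigM :=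
  {a | a ∈ algN c hc ∧ {n | a n ≠ 0}.Finite}

theorem single_twist_mem (c : ℕ+ → ℝ) (hc : ∀ n, 1 < c n) (n : ℕ+) (x : Mat n) :
    (lp.single ∞ n (twist c n x) : BigM) ∈ algA c hc := by
  classical
  refine ⟨fun m => ?_, ?_⟩
  · by_cases h : m = n
    · subst h
      exact ⟨x, by simp⟩
    · exact ⟨0, by rw [twist_zero]; exact Pi.single_eq_of_ne h _⟩
  · refine tendsto_const_nhds.congr' ?_
    filter_upwards [eventually_gt_atTop n] with k hk
    have hu : (uElt c hc k : ∀ m, Mat m × Mat m) n = 1 := by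
      change twist c n (uMat n k) = 1
      rw [uMat, if_neg (not_le.mpr hk), twist_one hc]
    have h1 : (lp.single ∞ n (twist c n x) : BigM) * uElt c hc k = lp.single ∞ n (twist c n x) := by
      ext1
      funext m
      rw [lp.infty_coeFn_mul, Pi.mul_apply]
      by_cases h : m = n
      · subst h; rw [hu, mul_one]
      · simp [Pi.single_eq_of_ne h]
    have h2 : uElt c hc k * (lp.single ∞ n (twist c n x) : BigM) = lp.single ∞ n (twist c n x) := by
      ext1
      funext m
      rw [lp.infty_coeFn_mul, Pi.mul_apply]
      by_cases h : m = n
      · subst h; rw [hu, one_mul]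
      · simp [Pi.single_eq_of_ne h]
    rw [h1, h2]
    simp

/-- The canonical copy in `A` of a matrix `x ∈ M_n`: the tuple with `n`-th entry
`(x, d_n x d_n⁻¹)` and all other entries zero. -/
def blockCopy (c : ℕ+ → ℝ) (hc : ∀ n, 1 < c n) (n : ℕ+) (x : Mat n) : AlgA c hc :=
  ⟨lp.single ∞ n (twist c n x), single_twist_mem c hc n x⟩

end

/-!
Every nonzero element of `A` has a two-sided multiple which is a minimal idempotent, since a nonzero
entry can be compressed to a rank one idempotent of its block. Hence both socles are the span of
the minimal idempotents, and the minimal idempotents live in single blocks, so this span is `A_00`.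

A maximal modular right ideal `J` missing a minimal idempotent `p` is complementary to the minimal
right ideal `p A`, and the component in `p A` of a modular unit is a minimal idempotent `e` with
`J = (1 - e) A`. So it remains to see that `J` cannot contain `A_00`, which holds because `A / A_00`
is a radical algebra: for `a ∈ A`, the element `1 - a` is invertible off finitely many blocks.
Indeed the second components of `u_k` decay geometrically along the blocks, so those of `a` tend
to `0`; as `x ↦ d_n x d_n⁻¹` amplifies the strictly lower triangular part of `x`, those parts of the
first components tend to `0` too. Up to a summand tending to `0`, `a` is therefore a tuple of pairs
`(t_n, 0)` with `t_n` upper triangular. Such a tuple `t` is close to `t u_k` off finitely many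
blocks, where `t u_k` is strictly upper triangular with at least `n / k` vanishing diagonals and
hence nilpotent of order at most `k`. Thus `1 - t = v - t u_k` with `v = 1 - (t - t u_k)` invertible
and upper triangular, and `v⁻¹ t u_k` is nilpotent. Left ideals follow by passing to the opposite
algebra.
-/

section AbstractAlgebra

open MulOpposite

variable {A : Type*} [NonUnitalRing A] [Module ℂ A]

theorem IsMinimalIdempotent.exists_mul_mul_eq_smul {e : A} (he : IsMinimalIdempotent e) (a : A) :
    ∃ z : ℂ, e * a * e = z • e := by
  obtain ⟨z, hz⟩ := he.2.2.subset ⟨a, rfl⟩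
  exact ⟨z, hz.symm⟩

theorem IsRightIdeal.sup {J K : Submodule ℂ A} (hJ : IsRightIdeal J) (hK : IsRightIdeal K) :
    IsRightIdeal (J ⊔ K) := by
  intro a x hx
  obtain ⟨y, hy, z, hz, rfl⟩ := Submodule.mem_sup.mp hx
  rw [add_mul]
  exact Submodule.add_mem_sup (hJ a y hy) (hK a z hz)

theorem IsRightIdeal.inf {J K : Submodule ℂ A} (hJ : IsRightIdeal J) (hK : IsRightIdeal K) :
    IsRightIdeal (J ⊓ K) :=
  fun a x hx => ⟨hJ a x hx.1, hK a x hx.2⟩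

theorem IsMaximalModularRightIdeal.isRightIdeal {J : Submodule ℂ A}
    (hJ : IsMaximalModularRightIdeal J) : IsRightIdeal J :=
  hJ.prop.1.1

theorem IsMaximalModularRightIdeal.sup_eq_top {J K : Submodule ℂ A}
    (hJ : IsMaximalModularRightIdeal J) (hK : IsRightIdeal K) (hKJ : ¬K ≤ J) : J ⊔ K = ⊤ := by
  obtain ⟨⟨hJr, u, hu⟩, -⟩ := hJ.prop
  by_contra hne
  exact hKJ (le_sup_right.trans
    (hJ.le_of_ge ⟨⟨hJr.sup hK, u, fun a => le_sup_left (a := J) (hu a)⟩, hne⟩ le_sup_left))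

theorem IsMinimalRightIdeal.le_of_inf_ne_bot {J R : Submodule ℂ A} (hR : IsMinimalRightIdeal R)
    (hJ : IsRightIdeal J) (h : J ⊓ R ≠ ⊥) : R ≤ J :=
  (hR.le_of_le ⟨hJ.inf hR.prop.1, h⟩ inf_le_right).trans inf_le_left

/-- Every nonzero element has a two-sided multiple which is a minimal idempotent. This makes the
algebra semiprime with essential socle. -/
def HasEnoughMinimalIdempotents (A : Type*) [NonUnitalRing A] [Module ℂ A] : Prop :=
  ∀ b : A, b ≠ 0 → ∃ x y : A, IsMinimalIdempotent (x * b * y)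

/-- The quotient `A / I` is a radical algebra: every element of `A` has a two-sided quasi-inverse
modulo `I`, in the sign convention `(1 - u) (1 + q) ≡ 1 ≡ (1 + q) (1 - u)`. -/
def IsRadicalModulo (I : Submodule ℂ A) : Prop :=
  ∀ u : A, ∃ q : A, q - u - u * q ∈ I ∧ q - u - q * u ∈ I

/-- The linear span of the minimal idempotents. -/
def minimalIdempotentSpan (A : Type*) [NonUnitalRing A] [Module ℂ A] : Submodule ℂ A :=
  Submodule.span ℂ {e | IsMinimalIdempotent e}

theorem IsMinimalIdempotent.mem_minimalIdempotentSpan {e : A} (he : IsMinimalIdempotent e) :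
    e ∈ minimalIdempotentSpan A :=
  Submodule.subset_span he

theorem IsModularRightIdeal.eq_top_of_isRadicalModulo {I J : Submodule ℂ A}
    (hJ : IsModularRightIdeal J) (hI : IsRadicalModulo I) (hIJ : I ≤ J) : J = ⊤ := by
  obtain ⟨hJr, u, hu⟩ := hJ
  obtain ⟨q, hq, -⟩ := hI u
  refine (Submodule.eq_top_iff').mpr fun b => ?_
  -- `b` is congruent to `(1 - u) (1 + q) b` modulo `I A`.
  have hb : b = (b + q * b) - u * (b + q * b) - (q - u - u * q) * b := by
    noncomm_ring
  rw [hb]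
  exact J.sub_mem (hu _) (hJr b _ (hIJ hq))

section RightIdeals

variable [SMulCommClass ℂ A A]

theorem HasEnoughMinimalIdempotents.exists_mul_mul_eq (h : HasEnoughMinimalIdempotents A) {e b : A}
    (he : IsMinimalIdempotent e) (hb : e * b ≠ 0) : ∃ y, e * b * y = e := by
  obtain ⟨x, y, hf⟩ := h (e * b) hb
  obtain ⟨z, hz⟩ := he.exists_mul_mul_eq_smul (b * y * x)
  have hz0 : z ≠ 0 := by
    rintro rfl
    apply hf.1
    calc x * (e * b) * y = x * (e * b) * y * (x * (e * b) * y) := hf.2.1.symm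
      _ = x * (e * (b * y * x) * e) * b * y := by simp only [mul_assoc]
      _ = 0 := by rw [hz, zero_smul, mul_zero, zero_mul, zero_mul]
  refine ⟨z⁻¹ • (y * x * e), ?_⟩
  calc e * b * z⁻¹ • (y * x * e) = z⁻¹ • (e * (b * y * x) * e) := by
        rw [mul_smul_comm]; simp only [mul_assoc]
    _ = e := by rw [hz, inv_smul_smul₀ hz0]

theorem IsMinimalIdempotent.isMinimalRightIdeal_range_mulLeft {e : A} (he : IsMinimalIdempotent e)
    (h : HasEnoughMinimalIdempotents A) :
    IsMinimalRightIdeal (LinearMap.range (LinearMap.mulLeft ℂ e)) := by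
  have hmem : e ∈ LinearMap.range (LinearMap.mulLeft ℂ e) := ⟨e, he.2.1⟩
  refine ⟨⟨?_, fun hbot => he.1 ?_⟩, fun K ⟨hK, hK0⟩ hle => ?_⟩
  · rintro a _ ⟨x, rfl⟩
    exact ⟨x * a, (mul_assoc e x a).symm⟩
  · rwa [hbot, Submodule.mem_bot] at hmem
  · obtain ⟨b, hb, hb0⟩ := K.ne_bot_iff.mp hK0
    obtain ⟨x, rfl⟩ := hle hb
    obtain ⟨y, hy⟩ := h.exists_mul_mul_eq he hb0
    have heK : e ∈ K := hy ▸ hK y _ hb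
    rintro _ ⟨w, rfl⟩
    exact hK w e heK

theorem coe_ker_mulLeft_eq_range {e : A} (hee : e * e = e) :
    (LinearMap.ker (LinearMap.mulLeft ℂ e) : Set A) = Set.range fun a => a - e * a := by
  ext a
  simp only [SetLike.mem_coe, LinearMap.mem_ker, LinearMap.mulLeft_apply, Set.mem_range]
  constructor
  · exact fun h => ⟨a, by rw [h, sub_zero]⟩
  · rintro ⟨b, rfl⟩
    rw [mul_sub, ← mul_assoc, hee, sub_self]

theorem IsMinimalIdempotent.isMaximalModularRightIdeal_ker_mulLeft {e : A}
    (he : IsMinimalIdempotent e) (h : HasEnoughMinimalIdempotents A) :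
    IsMaximalModularRightIdeal (LinearMap.ker (LinearMap.mulLeft ℂ e)) := by
  refine ⟨⟨⟨fun a x hx => ?_, e, fun a => ?_⟩, fun htop => he.1 ?_⟩, fun K ⟨⟨hK, _⟩, hK1⟩ hle => ?_⟩
  · rw [LinearMap.mem_ker, LinearMap.mulLeft_apply] at hx ⊢
    rw [← mul_assoc, hx, zero_mul]
  · exact (coe_ker_mulLeft_eq_range he.2.1).superset ⟨a, rfl⟩
  · rw [← he.2.1]
    exact htop.ge (Submodule.mem_top : e ∈ ⊤)
  · intro b hb
    by_contra hb0
    apply hK1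
    obtain ⟨y, hy⟩ := h.exists_mul_mul_eq he (b := b) hb0
    have hsub (a : A) : a - e * a ∈ K :=
      hle ((coe_ker_mulLeft_eq_range he.2.1).superset ⟨a, rfl⟩)
    have heb : e * b ∈ K := by simpa using K.sub_mem hb (hsub b)
    have heK : e ∈ K := hy ▸ hK y _ heb
    refine (Submodule.eq_top_iff').mpr fun a => ?_
    simpa using K.add_mem (hsub a) (hK a e heK)

variable [IsScalarTower ℂ A A]

theorem isMinimalIdempotent_iff {e : A} :
    IsMinimalIdempotent e ↔ e ≠ 0 ∧ e * e = e ∧ ∀ a, ∃ z : ℂ, e * a * e = z • e := by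
  refine ⟨fun he => ⟨he.1, he.2.1, he.exists_mul_mul_eq_smul⟩, fun ⟨h0, hee, h⟩ => ⟨h0, hee, ?_⟩⟩
  apply Set.Subset.antisymm
  · rintro _ ⟨a, rfl⟩
    obtain ⟨z, hz⟩ := h a
    exact ⟨z, hz.symm⟩
  · rintro _ ⟨z, rfl⟩
    exact ⟨z • e, by simp only [mul_smul_comm, smul_mul_assoc, hee]⟩

theorem IsMinimalIdempotent.of_mul_eq {e f : A} (he : IsMinimalIdempotent e) (hf0 : f ≠ 0)
    (hff : f * f = f) (hef : e * f = f) : IsMinimalIdempotent f := by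
  refine isMinimalIdempotent_iff.mpr ⟨hf0, hff, fun a => ?_⟩
  obtain ⟨z, hz⟩ := he.exists_mul_mul_eq_smul (f * a)
  refine ⟨z, ?_⟩
  calc f * a * f = e * (f * a) * e * f := by simp only [← mul_assoc, hef]; rw [mul_assoc _ e, hef]
    _ = z • f := by rw [hz, smul_mul_assoc, hef]

theorem isRightIdeal_minimalIdempotentSpan : IsRightIdeal (minimalIdempotentSpan A) := by
  intro a x hx
  induction hx using Submodule.span_induction with
  | zero => rw [zero_mul]; exact zero_mem _
  | add x y _ _ hx hy => rw [add_mul]; exact add_mem hx hy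
  | smul z x _ hx => rw [smul_mul_assoc]; exact Submodule.smul_mem _ z hx
  | mem e he =>
    -- `f` is an idempotent with `e f = f` and `f e = e`.
    set f := e + e * a - e * a * e with hf
    have hee : e * e = e := he.2.1
    have hef : e * f = f := by
      rw [hf]; simp only [mul_add, mul_sub, ← mul_assoc, hee]
    have hfe : f * e = e := by
      rw [hf]; simp only [add_mul, sub_mul, mul_assoc, hee]; abel
    have hf0 : f ≠ 0 := fun h => he.1 (by rw [← hfe, h, zero_mul])
    have hff : f * f = f := by
      calc f * f = f * e * f := by rw [mul_assoc, hef]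
        _ = f := by rw [hfe, hef]
    obtain ⟨z, hz⟩ := he.exists_mul_mul_eq_smul a
    have hea : e * a = f - e + z • e := by rw [hf, hz]; abel
    rw [hea]
    exact add_mem (sub_mem (he.of_mul_eq hf0 hff hef).mem_minimalIdempotentSpan
      he.mem_minimalIdempotentSpan) (Submodule.smul_mem _ z he.mem_minimalIdempotentSpan)

theorem IsMaximalModularRightIdeal.exists_eq_ker_mulLeft {J : Submodule ℂ A}
    (hJ : IsMaximalModularRightIdeal J) (h : HasEnoughMinimalIdempotents A) {p : A}
    (hp : IsMinimalIdempotent p) (hpJ : p ∉ J) :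
    ∃ e, IsMinimalIdempotent e ∧ J = LinearMap.ker (LinearMap.mulLeft ℂ e) := by
  set R := LinearMap.range (LinearMap.mulLeft ℂ p)
  have hR : IsMinimalRightIdeal R := hp.isMinimalRightIdeal_range_mulLeft h
  have hRJ : ¬R ≤ J := fun hle => hpJ (hle ⟨p, hp.2.1⟩)
  have htop : J ⊔ R = ⊤ := hJ.sup_eq_top hR.prop.1 hRJ
  have hbot {a : A} (ha : a ∈ J) (ha' : a ∈ R) : a = 0 := by
    have hinf : J ⊓ R = ⊥ := by_contra fun hne => hRJ (hR.le_of_inf_ne_bot hJ.isRightIdeal hne)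
    exact (Submodule.mem_bot ℂ).mp (hinf ▸ ⟨ha, ha'⟩)
  obtain ⟨⟨hJr, u, hu⟩, hJ1⟩ := hJ.prop
  -- The component in `R` of a modular unit is the required idempotent.
  obtain ⟨j, hj, e, heR, rfl⟩ := Submodule.mem_sup.mp (htop ▸ Submodule.mem_top : u ∈ J ⊔ R)
  have hsub (a : A) : a - e * a ∈ J := by
    have := J.add_mem (hu a) (hJr a j hj)
    rwa [add_mul, sub_add_eq_add_sub, add_comm (j * a), add_sub_add_right_eq_sub] at this
  have hRe (a : A) : e * a ∈ R := hR.prop.1 a e heR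
  have hee : e * e = e := (sub_eq_zero.mp (hbot (hsub e) (R.sub_mem heR (hRe e)))).symm
  have hpe : p * e = e := by
    obtain ⟨x, rfl⟩ := heR
    rw [LinearMap.mulLeft_apply, ← mul_assoc, hp.2.1]
  have he0 : e ≠ 0 := by
    rintro rfl
    exact hJ1 ((Submodule.eq_top_iff').mpr fun a => by simpa using hsub a)
  refine ⟨e, hp.of_mul_eq he0 hee hpe, le_antisymm (fun a ha => ?_) fun a ha => ?_⟩
  · have hea : e * a ∈ J := by simpa using J.sub_mem ha (hsub a)
    exact hbot hea (hRe a)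
  · simpa [show e * a = 0 from ha] using hsub a

theorem isMaximalModularRightIdeal_iff (h : HasEnoughMinimalIdempotents A)
    (hrad : IsRadicalModulo (minimalIdempotentSpan A)) {J : Submodule ℂ A} :
    IsMaximalModularRightIdeal J ↔
      ∃ e, IsMinimalIdempotent e ∧ (J : Set A) = Set.range fun a => a - e * a := by
  constructor
  · intro hJ
    obtain ⟨p, hp, hpJ⟩ : ∃ p, IsMinimalIdempotent p ∧ p ∉ J := by
      by_contra! hle
      exact hJ.prop.2 (hJ.prop.1.eq_top_of_isRadicalModulo hrad (Submodule.span_le.mpr hle))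
    obtain ⟨e, he, rfl⟩ := hJ.exists_eq_ker_mulLeft h hp hpJ
    exact ⟨e, he, coe_ker_mulLeft_eq_range he.2.1⟩
  · rintro ⟨e, he, hJ⟩
    rw [← coe_ker_mulLeft_eq_range he.2.1, SetLike.coe_set_eq] at hJ
    exact hJ ▸ he.isMaximalModularRightIdeal_ker_mulLeft h

end RightIdeals

section Opposite

/-- The correspondence between the linear subspaces of `A` and those of the opposite algebra. It
exchanges left and right ideals. -/
noncomputable def opSubmodule : Submodule ℂ A ≃o Submodule ℂ Aᵐᵒᵖ :=
  Submodule.orderIsoMapComap (opLinearEquiv ℂ : A ≃ₗ[ℂ] Aᵐᵒᵖ)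

theorem mem_opSubmodule {J : Submodule ℂ A} {a : Aᵐᵒᵖ} : a ∈ opSubmodule J ↔ unop a ∈ J :=
  Submodule.mem_map_equiv J (e := (opLinearEquiv ℂ : A ≃ₗ[ℂ] Aᵐᵒᵖ))

theorem isRightIdeal_opSubmodule {J : Submodule ℂ A} :
    IsRightIdeal (opSubmodule J) ↔ IsLeftIdeal J := by
  simp only [IsRightIdeal, IsLeftIdeal, op_surjective.forall, mem_opSubmodule, unop_mul, unop_op]

theorem isModularRightIdeal_opSubmodule {J : Submodule ℂ A} :
    IsModularRightIdeal (opSubmodule J) ↔ IsModularLeftIdeal J := by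
  simp only [IsModularRightIdeal, IsModularLeftIdeal, isRightIdeal_opSubmodule,
    op_surjective.forall, op_surjective.exists, mem_opSubmodule, unop_sub, unop_mul, unop_op]

theorem isMaximalModularRightIdeal_opSubmodule {J : Submodule ℂ A} :
    IsMaximalModularRightIdeal (opSubmodule J) ↔ IsMaximalModularLeftIdeal J := by
  simp only [IsMaximalModularRightIdeal, IsMaximalModularLeftIdeal, Maximal,
    opSubmodule.surjective.forall, isModularRightIdeal_opSubmodule,
    opSubmodule.injective.ne_iff' opSubmodule.map_top, opSubmodule.le_iff_le]

theorem isMinimalRightIdeal_opSubmodule {J : Submodule ℂ A} :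
    IsMinimalRightIdeal (opSubmodule J) ↔ IsMinimalLeftIdeal J := by
  simp only [IsMinimalRightIdeal, IsMinimalLeftIdeal, Minimal, opSubmodule.surjective.forall,
    isRightIdeal_opSubmodule, opSubmodule.injective.ne_iff' opSubmodule.map_bot,
    opSubmodule.le_iff_le]

theorem rightSocle_mulOpposite : rightSocle Aᵐᵒᵖ = opSubmodule (leftSocle A) := by
  rw [leftSocle, rightSocle, map_sSup opSubmodule]
  congr 1
  ext J
  obtain ⟨J, rfl⟩ := opSubmodule.surjective J
  simp [isMinimalRightIdeal_opSubmodule]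

theorem isMinimalIdempotent_op {e : A} : IsMinimalIdempotent (op e) ↔ IsMinimalIdempotent e := by
  have hrange : (Set.range fun z : ℂ => z • op e) = op '' Set.range fun z : ℂ => z • e := by
    rw [← Set.range_comp]; rfl
  have hrange' : (Set.range fun a : Aᵐᵒᵖ => op e * a * op e) =
      op '' Set.range fun a : A => e * a * e := by
    rw [← Set.range_comp, ← op_surjective.range_comp]
    simp only [Function.comp_def, ← op_mul, mul_assoc]
  rw [IsMinimalIdempotent, IsMinimalIdempotent, hrange, hrange',
    op_injective.image_injective.eq_iff, ← op_mul, op_inj, op_ne_zero_iff]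

theorem minimalIdempotentSpan_mulOpposite :
    minimalIdempotentSpan Aᵐᵒᵖ = opSubmodule (minimalIdempotentSpan A) := by
  have himage : {e : Aᵐᵒᵖ | IsMinimalIdempotent e} =
      (opLinearEquiv ℂ : A ≃ₗ[ℂ] Aᵐᵒᵖ) '' {e | IsMinimalIdempotent e} := by
    ext e
    obtain ⟨e, rfl⟩ := op_surjective e
    simp [isMinimalIdempotent_op]
  rw [minimalIdempotentSpan, himage]
  exact Submodule.span_image (opLinearEquiv ℂ : A ≃ₗ[ℂ] Aᵐᵒᵖ).toLinearMap

theorem HasEnoughMinimalIdempotents.mulOpposite (h : HasEnoughMinimalIdempotents A) :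
    HasEnoughMinimalIdempotents Aᵐᵒᵖ := by
  intro b hb
  obtain ⟨x, y, hxy⟩ := h (unop b) (unop_ne_zero_iff b |>.mpr hb)
  refine ⟨op y, op x, ?_⟩
  rw [mul_assoc, ← op_unop b, ← op_mul, ← op_mul]
  exact isMinimalIdempotent_op.mpr hxy

theorem IsRadicalModulo.opSubmodule {I : Submodule ℂ A} (h : IsRadicalModulo I) :
    IsRadicalModulo (opSubmodule I) := by
  intro u
  obtain ⟨q, hq, hq'⟩ := h (unop u)
  exact ⟨op q, mem_opSubmodule.mpr hq', mem_opSubmodule.mpr hq⟩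

end Opposite

section TwoSided

variable [IsScalarTower ℂ A A] [SMulCommClass ℂ A A]

theorem isMaximalModularLeftIdeal_iff (h : HasEnoughMinimalIdempotents A)
    (hrad : IsRadicalModulo (minimalIdempotentSpan A)) {J : Submodule ℂ A} :
    IsMaximalModularLeftIdeal J ↔
      ∃ e, IsMinimalIdempotent e ∧ (J : Set A) = Set.range fun a => a - a * e := by
  rw [← isMaximalModularRightIdeal_opSubmodule, isMaximalModularRightIdeal_iff h.mulOpposite
    (minimalIdempotentSpan_mulOpposite (A := A) ▸ hrad.opSubmodule), op_surjective.exists]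
  refine exists_congr fun e => and_congr isMinimalIdempotent_op ?_
  simp only [Set.ext_iff, op_surjective.forall, SetLike.mem_coe, mem_opSubmodule, unop_op,
    Set.mem_range, op_surjective.exists, ← op_mul, ← op_sub, op_inj]

theorem isLeftIdeal_minimalIdempotentSpan : IsLeftIdeal (minimalIdempotentSpan A) := by
  rw [← isRightIdeal_opSubmodule, ← minimalIdempotentSpan_mulOpposite]
  exact isRightIdeal_minimalIdempotentSpan

theorem rightSocle_eq_minimalIdempotentSpan (h : HasEnoughMinimalIdempotents A) :
    rightSocle A = minimalIdempotentSpan A := by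
  apply le_antisymm
  · refine sSup_le fun R (hR : IsMinimalRightIdeal R) => ?_
    obtain ⟨b, hbR, hb⟩ := R.ne_bot_iff.mp hR.prop.2
    obtain ⟨x, y, hf⟩ := h b hb
    set f := x * b * y with hf_def
    refine hR.le_of_inf_ne_bot isRightIdeal_minimalIdempotentSpan
      (Submodule.ne_bot_iff _ |>.mpr ⟨b * y * f, ⟨?_, ?_⟩, fun h0 => hf.1 ?_⟩)
    · exact isLeftIdeal_minimalIdempotentSpan _ _ hf.mem_minimalIdempotentSpan
    · exact hR.prop.1 _ _ (hR.prop.1 _ _ hbR)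
    · calc f = f * f := hf.2.1.symm
        _ = x * (b * y * f) := by rw [hf_def]; simp only [mul_assoc]
        _ = 0 := by rw [h0, mul_zero]
  · exact Submodule.span_le.mpr fun e he =>
      le_sSup (Set.mem_ofPred_eq.mpr (he.isMinimalRightIdeal_range_mulLeft h)) ⟨e, he.2.1⟩

theorem leftSocle_eq_minimalIdempotentSpan (h : HasEnoughMinimalIdempotents A) :
    leftSocle A = minimalIdempotentSpan A := by
  apply opSubmodule.injective
  rw [← rightSocle_mulOpposite, ← minimalIdempotentSpan_mulOpposite,
    rightSocle_eq_minimalIdempotentSpan h.mulOpposite]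

end TwoSided

end AbstractAlgebra

section BoundedSequences

theorem cofinite_le_atTop (α : Type*) [LinearOrder α] [LocallyFiniteOrderBot α] :
    (cofinite : Filter α) ≤ atTop := by
  refine le_iInf fun a => le_principal_iff.mpr ?_
  rw [mem_cofinite, Set.compl_Ici]
  exact Set.finite_Iio a

theorem isUnit_sub_of_isNilpotent {R : Type*} [Ring R] (v : Rˣ) {s : R}
    (hs : IsNilpotent (↑v⁻¹ * s)) : IsUnit (↑v - s) := by
  have : ↑v - s = v * (1 - ↑v⁻¹ * s) := by rw [mul_sub, mul_one, Units.mul_inv_cancel_left]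
  exact this ▸ v.isUnit.mul hs.isUnit_one_sub

theorem isUnit_one_sub_mul_one_sub {R : Type*} [Ring R] {p w : R} (hp : IsIdempotentElem p)
    (hcomm : ∀ a, Commute p a) (hw : IsUnit w) : IsUnit (1 - p * (1 - w)) := by
  have hpp (a b : R) : p * a * (p * b) = p * (a * b) := by
    rw [mul_assoc, ← mul_assoc a, ← (hcomm a).eq, mul_assoc p, ← mul_assoc p, hp.eq]
  obtain ⟨w, rfl⟩ := hw
  have key {v w : R} (h : v * w = 1) : (1 - p * (1 - v)) * (1 - p * (1 - w)) = 1 := by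
    calc (1 - p * (1 - v)) * (1 - p * (1 - w))
        = 1 - p * (1 - v) - p * (1 - w) + p * (1 - v) * (p * (1 - w)) := by noncomm_ring
      _ = 1 - p * (1 - v * w) := by rw [hpp]; noncomm_ring
      _ = 1 := by rw [h, sub_self, mul_zero, sub_zero]
  exact ⟨⟨_, _, key w.mul_inv, key w.inv_mul⟩, rfl⟩

theorem mul_quasiInverse_sub_eq_zero {R : Type*} [Ring R] {p u : R} (hp : IsIdempotentElem p)
    (hcomm : ∀ a, Commute p a) {w : Rˣ} (hw : ↑w = 1 - p * u) :
    p * (↑w⁻¹ * p * u - u - u * (↑w⁻¹ * p * u)) = 0 := by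
  set q := ↑w⁻¹ * p * u with hq
  have hpq : p * q = q := by
    rw [hq, ← (hcomm _).eq, ← mul_assoc, ← mul_assoc, hp.eq]
  have hwq : q - p * u * q = p * u := by
    rw [← one_sub_mul, ← hw, hq, mul_assoc, Units.mul_inv_cancel_left]
  rw [mul_sub, mul_sub, hpq, ← mul_assoc, sub_right_comm, hwq, sub_self]

variable {ι : Type*} {E : ι → Type*} [∀ i, NormedRing (E i)]
  [∀ i, NormOneClass (E i)]

theorem units_inv_apply_mul (w : (lp E ∞)ˣ) (i : ι) : (w⁻¹).1 i * w.1 i = 1 := by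
  rw [← Pi.mul_apply, ← lp.infty_coeFn_mul, w.inv_mul, lp.infty_coeFn_one, Pi.one_apply]

variable [DecidableEq ι]

/-- The central idempotent of `ℓ^∞(E)` which vanishes on the finite set `S` and is `1` off `S`:
multiplication by it discards the entries in `S`. -/
noncomputable def tailIdempotent (E : ι → Type*) [∀ i, NormedRing (E i)] [∀ i, NormOneClass (E i)]
    (S : Finset ι) : lp E ∞ :=
  ⟨fun i => if i ∈ S then 0 else 1, memℓp_infty ⟨1, by
    rintro _ ⟨i, rfl⟩
    dsimp only
    split_ifs <;> simp⟩⟩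

theorem tailIdempotent_apply (S : Finset ι) (i : ι) :
    tailIdempotent E S i = if i ∈ S then 0 else 1 :=
  rfl

theorem tailIdempotent_mul_apply (S : Finset ι) (a : lp E ∞) (i : ι) :
    (tailIdempotent E S * a) i = if i ∈ S then 0 else a i := by
  rw [lp.infty_coeFn_mul, Pi.mul_apply, tailIdempotent_apply, ite_mul, zero_mul, one_mul]

theorem tailIdempotent_commute (S : Finset ι) (a : lp E ∞) : Commute (tailIdempotent E S) a := by
  ext i
  rw [tailIdempotent_mul_apply, lp.infty_coeFn_mul, Pi.mul_apply, tailIdempotent_apply, mul_ite,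
    mul_zero, mul_one]

theorem tailIdempotent_mul_tailIdempotent_of_subset {S T : Finset ι} (h : S ⊆ T) :
    tailIdempotent E T * tailIdempotent E S = tailIdempotent E T := by
  ext i
  rw [tailIdempotent_mul_apply, tailIdempotent_apply, tailIdempotent_apply]
  split_ifs with hT hS
  · rfl
  · exact absurd (h hS) hT
  · rfl

theorem finite_support_of_tailIdempotent_mul_eq_zero {S : Finset ι} {a : lp E ∞}
    (h : tailIdempotent E S * a = 0) : {i | a i ≠ 0}.Finite := by
  refine S.finite_toSet.subset fun i hi => by_contra fun hiS => hi ?_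
  have hi0 := tailIdempotent_mul_apply S a i
  rw [h, if_neg (mt Finset.mem_coe.mpr hiS)] at hi0
  exact hi0.symm

theorem isIdempotentElem_tailIdempotent (S : Finset ι) : IsIdempotentElem (tailIdempotent E S) :=
  tailIdempotent_mul_tailIdempotent_of_subset subset_rfl

theorem norm_tailIdempotent_le (S : Finset ι) : ‖tailIdempotent E S‖ ≤ 1 := by
  refine lp.norm_le_of_forall_le zero_le_one fun i => ?_
  rw [tailIdempotent_apply]
  split_ifs <;> simp

theorem tendsto_tailIdempotent_mul {s : lp E ∞} (hs : Tendsto (fun i => ‖s i‖) cofinite (𝓝 0)) :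
    Tendsto (fun S => tailIdempotent E S * s) atTop (𝓝 0) := by
  refine NormedAddGroup.tendsto_nhds_zero.mpr fun ε hε => ?_
  have hfin : {i | ¬‖s i‖ < ε / 2}.Finite := hs.eventually_lt_const (half_pos hε)
  filter_upwards [eventually_ge_atTop hfin.toFinset] with S hS
  refine (lp.norm_le_of_forall_le (half_pos hε).le fun i => ?_).trans_lt (half_lt_self hε)
  rw [tailIdempotent_mul_apply]
  split_ifs with hi
  · rw [norm_zero]; exact (half_pos hε).le
  · by_contra hlt
    exact hi (hS (hfin.mem_toFinset.mpr fun h => hlt h.le))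

theorem exists_isUnit_one_sub_tailIdempotent_mul_add [∀ i, CompleteSpace (E i)] {s t : lp E ∞}
    (hs : Tendsto (fun i => ‖s i‖) cofinite (𝓝 0)) {S₀ : Finset ι}
    (ht : IsUnit (1 - tailIdempotent E S₀ * t)) :
    ∃ S, IsUnit (1 - tailIdempotent E S * (t + s)) := by
  have hlim : Tendsto (fun S => 1 - tailIdempotent E S₀ * t - tailIdempotent E S * s) atTop
      (𝓝 (1 - tailIdempotent E S₀ * t)) := by
    simpa using (tendsto_tailIdempotent_mul hs).const_sub (1 - tailIdempotent E S₀ * t)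
  obtain ⟨S, hS, hunit⟩ := ((eventually_ge_atTop S₀).and
    (hlim.eventually (Units.isOpen.mem_nhds ht))).exists
  refine ⟨S, ?_⟩
  -- The units at hand agree with `1 - (t + s)` off `S`, and masking them by `1` on `S` keeps them
  -- invertible.
  convert isUnit_one_sub_mul_one_sub (isIdempotentElem_tailIdempotent S) (tailIdempotent_commute S)
    hunit using 2
  rw [show (1 : lp E ∞) - (1 - tailIdempotent E S₀ * t - tailIdempotent E S * s) =
    tailIdempotent E S₀ * t + tailIdempotent E S * s by abel, mul_add, mul_add, ← mul_assoc,
    ← mul_assoc, tailIdempotent_mul_tailIdempotent_of_subset hS,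
    (isIdempotentElem_tailIdempotent S).eq]

end BoundedSequences

section UpperBand

/-- The matrices whose entries vanish below the `m`-th superdiagonal; `m = 0` gives the upper
triangular matrices. -/
def upperBand (R : Type*) [Semiring R] (n m : ℕ) : Submodule R (Matrix (Fin n) (Fin n) R) where
  carrier := {x | ∀ i j : Fin n, (j : ℕ) < i + m → x i j = 0}
  add_mem' hx hy i j h := by rw [Matrix.add_apply, hx i j h, hy i j h, add_zero]
  zero_mem' _ _ _ := rfl
  smul_mem' z x hx i j h := by rw [Matrix.smul_apply, hx i j h, smul_zero]

variable {R : Type*} {n l m : ℕ}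

section Semiring

variable [Semiring R] {x y : Matrix (Fin n) (Fin n) R}

theorem upperBand_antitone (R : Type*) [Semiring R] (n : ℕ) : Antitone (upperBand R n) :=
  fun _ _ h _ hx i j hij => hx i j (hij.trans_le (Nat.add_le_add_left h i))

theorem upperBand_eq_bot (h : n ≤ m) : upperBand R n m = ⊥ :=
  (Submodule.eq_bot_iff _).mpr fun x hx => by
    ext i j
    exact hx i j (by lia)

theorem one_mem_upperBand : (1 : Matrix (Fin n) (Fin n) R) ∈ upperBand R n 0 :=
  fun _ _ h => Matrix.one_apply_ne (Fin.ne_of_gt h)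

theorem mul_mem_upperBand (hx : x ∈ upperBand R n l) (hy : y ∈ upperBand R n m) :
    x * y ∈ upperBand R n (l + m) := by
  intro i j h
  rw [Matrix.mul_apply]
  refine Finset.sum_eq_zero fun k _ => ?_
  by_cases hk : (k : ℕ) < i + l
  · rw [hx i k hk, zero_mul]
  · rw [hy k j (by lia), mul_zero]

theorem pow_mem_upperBand (hx : x ∈ upperBand R n m) (k : ℕ) : x ^ k ∈ upperBand R n (k * m) := by
  induction k with
  | zero => simpa using one_mem_upperBand
  | succ k ih => rw [pow_succ, Nat.succ_mul]; exact mul_mem_upperBand ih hx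

theorem pow_eq_zero_of_mem_upperBand (hx : x ∈ upperBand R n m) {k : ℕ} (h : n ≤ k * m) :
    x ^ k = 0 :=
  (Submodule.mem_bot R).mp (upperBand_eq_bot (R := R) h ▸ pow_mem_upperBand hx k)

end Semiring

theorem mem_upperBand_zero_of_mul_eq_one [CommRing R] {x y : Matrix (Fin n) (Fin n) R}
    (hx : x ∈ upperBand R n 0) (h : y * x = 1) : y ∈ upperBand R n 0 := by
  let _ : Invertible x := ⟨y, h, mul_eq_one_comm.mp h⟩
  have hb : x.BlockTriangular id := fun i j hij => hx i j hij
  have hb' := Matrix.blockTriangular_inv_of_blockTriangular hb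
  rw [Matrix.inv_eq_left_inv h] at hb'
  exact fun i j hij => hb' hij

end UpperBand

section Shift

variable {n : ℕ+}

theorem shiftMat_pow_apply (l : ℕ) (i j : Fin n) :
    (shiftMat n ^ l) i j = if (j : ℕ) = i + l then 1 else 0 := by
  induction l generalizing i with
  | zero => simp [Matrix.one_apply, Fin.ext_iff, eq_comm]
  | succ l ih =>
    simp only [pow_succ', Matrix.mul_apply, ih]
    simp only [shiftMat, Matrix.of_apply, ite_mul, one_mul, zero_mul]
    by_cases h : (i : ℕ) + 1 < n
    · rw [Finset.sum_eq_single (⟨i + 1, h⟩ : Fin n)]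
      · simp [add_assoc, add_comm 1 l]
      · exact fun b _ hb => if_neg fun e => hb (Fin.ext e)
      · simp
    · rw [if_neg (by lia)]
      exact Finset.sum_eq_zero fun b _ => if_neg (by lia)

theorem shiftMat_pow_mem_upperBand (l : ℕ) : shiftMat n ^ l ∈ upperBand ℂ n l := fun i j h => by
  rw [shiftMat_pow_apply, if_neg h.ne]

theorem norm_shiftMat_pow_le (l : ℕ) : ‖shiftMat n ^ l‖ ≤ 1 :=
  (norm_pow_le _ l).trans (pow_le_one₀ (norm_nonneg _) (norm_shiftMat_le n))

theorem uMat_mem_upperBand {k : ℕ+} (h : k ≤ n) :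
    uMat n k ∈ upperBand ℂ n ⌈(n : ℚ) / (k : ℚ)⌉₊ := by
  rw [uMat, if_pos h]
  refine Submodule.smul_mem _ _ (Submodule.sum_mem _ fun i hi => ?_)
  exact upperBand_antitone ℂ n (Finset.mem_Icc.mp hi).1 (shiftMat_pow_mem_upperBand i)

theorem uMat_mem_upperBand_zero (n k : ℕ+) : uMat n k ∈ upperBand ℂ n 0 := by
  by_cases h : k ≤ n
  · exact upperBand_antitone ℂ n (Nat.zero_le _) (uMat_mem_upperBand h)
  · rw [uMat, if_neg h]
    exact one_mem_upperBand

theorem le_mul_ceil_div (n k : ℕ+) : (n : ℕ) ≤ k * ⌈(n : ℚ) / (k : ℚ)⌉₊ := by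
  have hk : (0 : ℚ) < k := by exact_mod_cast k.pos
  have hceil := Nat.le_ceil ((n : ℚ) / (k : ℚ))
  rw [div_le_iff₀' hk] at hceil
  exact_mod_cast hceil

end Shift

section Twist

variable {c : ℕ+ → ℝ} {n : ℕ+}

theorem twist_fst (x : Mat n) : (twist c n x).1 = x :=
  rfl

theorem twist_snd_shiftMat_pow (hc : ∀ n, 1 < c n) (l : ℕ) :
    (twist c n (shiftMat n ^ l)).2 = (c n : ℂ)⁻¹ ^ l • shiftMat n ^ l := by
  rw [twist_pow hc, Prod.pow_snd, ← smul_pow, ← dMat_mul_shiftMat hc]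
  rfl

theorem norm_twist_uMat_snd_le (hc : ∀ n, 1 < c n) {k : ℕ+} (h : k ≤ n) :
    ‖(twist c n (uMat n k)).2‖ ≤ (c n)⁻¹ ^ ⌈(n : ℚ) / (k : ℚ)⌉₊ := by
  have hpos : 0 < c n := one_pos.trans (hc n)
  have hterm (i : ℕ) (hi : i ∈ intInterval n k) :
      ‖(twist c n (shiftMat n ^ i)).2‖ ≤ (c n)⁻¹ ^ ⌈(n : ℚ) / (k : ℚ)⌉₊ := by
    rw [twist_snd_shiftMat_pow hc, norm_smul, norm_pow, norm_inv, Complex.norm_real,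
      Real.norm_of_nonneg hpos.le]
    refine (mul_le_of_le_one_right (by positivity) (norm_shiftMat_pow_le i)).trans ?_
    exact pow_le_pow_of_le_one (by positivity) (inv_le_one_of_one_le₀ (hc n).le)
      (Finset.mem_Icc.mp hi).1
  rw [uMat, if_pos h, twist_smul, twist_sum, Prod.smul_snd, Prod.snd_sum, norm_smul, norm_inv,
    Complex.norm_natCast]
  calc ((intInterval n k).card : ℝ)⁻¹ * ‖∑ i ∈ intInterval n k, (twist c n (shiftMat n ^ i)).2‖
      ≤ ((intInterval n k).card : ℝ)⁻¹ *
        ((intInterval n k).card * (c n)⁻¹ ^ ⌈(n : ℚ) / (k : ℚ)⌉₊) := by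
        refine mul_le_mul_of_nonneg_left ((norm_sum_le_of_le _ hterm).trans_eq ?_) (by positivity)
        rw [Finset.sum_const, nsmul_eq_mul]
    _ ≤ (c n)⁻¹ ^ ⌈(n : ℚ) / (k : ℚ)⌉₊ := by
        rw [← mul_assoc]
        exact mul_le_of_le_one_left (by positivity) inv_mul_le_one

theorem tendsto_norm_twist_uMat_snd (hc : ∀ n, 1 < c n) {r : ℝ} (hr : 1 < r) (hrc : ∀ n, r ≤ c n)
    (k : ℕ+) : Tendsto (fun n => ‖(twist c n (uMat n k)).2‖) atTop (𝓝 0) := by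
  have hr0 : 0 < r := one_pos.trans hr
  have hk : (0 : ℚ) < k := by exact_mod_cast k.pos
  have hceil : Tendsto (fun n : ℕ+ => ⌈(n : ℚ) / (k : ℚ)⌉₊) atTop atTop :=
    tendsto_nat_ceil_atTop.comp ((tendsto_natCast_atTop_atTop.comp
      tendsto_PNat_val_atTop_atTop).atTop_div_const hk)
  refine squeeze_zero' (.of_forall fun n => norm_nonneg _) ?_
    ((tendsto_pow_atTop_nhds_zero_of_lt_one (inv_nonneg.mpr hr0.le)
      (inv_lt_one_of_one_lt₀ hr)).comp hceil)
  filter_upwards [eventually_ge_atTop k] with n hn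
  exact (norm_twist_uMat_snd_le hc hn).trans
    (pow_le_pow_left₀ (inv_nonneg.mpr (hr0.le.trans (hrc n))) (inv_anti₀ hr0 (hrc n)) _)

theorem twist_snd_apply (hc : ∀ n, 1 < c n) (x : Mat n) (i j : Fin n) :
    (twist c n x).2 i j * (c n : ℂ) ^ ((j : ℕ) + 1) = (c n : ℂ) ^ ((i : ℕ) + 1) * x i j := by
  have hmul : (twist c n x).2 * dMat c n = dMat c n * x := by
    rw [twist, Matrix.mul_assoc, Matrix.nonsing_inv_mul _ (isUnit_det_dMat hc n), mul_one]
  simpa only [dMat, Matrix.mul_diagonal, Matrix.diagonal_mul] using congrFun₂ hmul i j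

end Twist

section LowerPart

variable {c : ℕ+ → ℝ} {n : ℕ+}

theorem norm_entry_le_l2_opNorm {m n : Type*} [Fintype m] [Fintype n] [DecidableEq n]
    (x : Matrix m n ℂ) (i : m) (j : n) : ‖x i j‖ ≤ ‖x‖ := by
  have h := Matrix.l2_opNorm_mulVec x (EuclideanSpace.single j (1 : ℂ))
  rw [PiLp.norm_single, norm_one, mul_one] at h
  refine le_trans ?_ ((PiLp.norm_apply_le _ i).trans h)
  simp

/-- The `l`-th subdiagonal of a matrix: its entries `(i, j)` with `i = j + l`. -/
def subdiagPart (l : ℕ) (x : Mat n) : Mat n :=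
  Matrix.of fun i j => if (i : ℕ) = j + l then x i j else 0

theorem subdiagPart_eq_mul (l : ℕ) (x : Mat n) :
    subdiagPart l x = (shiftMat n ^ l).conjTranspose *
      Matrix.diagonal fun j : Fin n => if h : (j : ℕ) + l < n then x ⟨j + l, h⟩ j else 0 := by
  ext i j
  rw [Matrix.mul_diagonal, Matrix.conjTranspose_apply, shiftMat_pow_apply, subdiagPart,
    Matrix.of_apply]
  split_ifs with hij hl
  · have hi : (⟨j + l, hl⟩ : Fin n) = i := Fin.ext hij.symm
    rw [hi, star_one, one_mul]
  · exact absurd i.isLt (hij ▸ hl)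
  all_goals rw [star_zero, zero_mul]

theorem norm_subdiagPart_le (l : ℕ) (x : Mat n) : ‖subdiagPart l x‖ ≤ ‖x‖ := by
  rw [subdiagPart_eq_mul]
  refine (norm_mul_le _ _).trans ?_
  rw [Matrix.l2_opNorm_conjTranspose, Matrix.l2_opNorm_diagonal]
  refine (mul_le_of_le_one_left (norm_nonneg _) (norm_shiftMat_pow_le l)).trans ?_
  refine (pi_norm_le_iff_of_nonneg (norm_nonneg _)).mpr fun j => ?_
  split_ifs
  · exact norm_entry_le_l2_opNorm x _ _
  · simp

theorem subdiagPart_eq_smul_twist_snd (hc : ∀ n, 1 < c n) (l : ℕ) (x : Mat n) :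
    subdiagPart l x = (c n : ℂ)⁻¹ ^ l • subdiagPart l (twist c n x).2 := by
  have h0 : (c n : ℂ) ≠ 0 := by exact_mod_cast (one_pos.trans (hc n)).ne'
  ext i j
  simp only [subdiagPart, Matrix.smul_apply, Matrix.of_apply, smul_eq_mul]
  split_ifs with hij
  · have hx := twist_snd_apply hc x i j
    rw [inv_pow, ← div_eq_inv_mul, eq_div_iff (pow_ne_zero l h0)]
    refine mul_right_cancel₀ (pow_ne_zero ((j : ℕ) + 1) h0) ?_
    rw [hx, hij]
    ring
  · rw [mul_zero]

/-- The strictly lower triangular part of a matrix. -/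
def lowerPart (x : Mat n) : Mat n := Matrix.of fun i j => if j < i then x i j else 0

theorem sub_lowerPart_mem_upperBand (x : Mat n) : x - lowerPart x ∈ upperBand ℂ n 0 := by
  intro i j h
  simp [lowerPart, show j < i from h]

theorem lowerPart_eq_sum_subdiagPart (x : Mat n) :
    lowerPart x = ∑ l ∈ Finset.Ico 1 (n : ℕ), subdiagPart l x := by
  ext i j
  simp only [Matrix.sum_apply, lowerPart, subdiagPart, Matrix.of_apply]
  split_ifs with hji
  · rw [Finset.sum_eq_single_of_mem ((i : ℕ) - j) (Finset.mem_Ico.mpr (by lia))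
      fun l _ hl => if_neg (by lia), if_pos (by lia)]
  · exact (Finset.sum_eq_zero fun l hl => if_neg (by have := Finset.mem_Ico.mp hl; lia)).symm

-- Conjugation by `d_n` multiplies the `l`-th subdiagonal by `c_n ^ l`, so the bound is a geometric
-- series.
theorem norm_lowerPart_le (hc : ∀ n, 1 < c n) (x : Mat n) :
    ‖lowerPart x‖ ≤ ‖(twist c n x).2‖ / (c n - 1) := by
  have hpos : 0 < c n := one_pos.trans (hc n)
  have hterm (l : ℕ) : ‖subdiagPart l x‖ ≤ (c n)⁻¹ ^ l * ‖(twist c n x).2‖ := by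
    rw [subdiagPart_eq_smul_twist_snd hc, norm_smul, norm_pow, norm_inv, Complex.norm_real,
      Real.norm_of_nonneg hpos.le]
    gcongr
    exact norm_subdiagPart_le _ _
  calc ‖lowerPart x‖
      ≤ ∑ l ∈ Finset.Ico 1 (n : ℕ), (c n)⁻¹ ^ l * ‖(twist c n x).2‖ :=
        lowerPart_eq_sum_subdiagPart x ▸ norm_sum_le_of_le _ fun l _ => hterm l
    _ ≤ (c n)⁻¹ ^ 1 / (1 - (c n)⁻¹) * ‖(twist c n x).2‖ := by
        rw [← Finset.sum_mul]
        gcongr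
        exact geom_sum_Ico_le_of_lt_one (inv_nonneg.mpr hpos.le) (inv_lt_one_of_one_lt₀ (hc n))
    _ = ‖(twist c n x).2‖ / (c n - 1) := by
        have hne : c n - 1 ≠ 0 := (sub_pos.mpr (hc n)).ne'
        field_simp

end LowerPart

section MatrixIdempotents

variable {m : Type*} [Fintype m]

theorem isMinimalIdempotent_single [DecidableEq m] (i : m) :
    IsMinimalIdempotent (Matrix.single i i (1 : ℂ)) := by
  refine isMinimalIdempotent_iff.mpr ⟨fun h => ?_, ?_, fun a => ⟨a i i, ?_⟩⟩
  · simpa using congrFun₂ h i i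
  · rw [Matrix.single_mul_single_same, one_mul]
  · rw [Matrix.single_mul_mul_single, Matrix.smul_single, one_mul, mul_one, smul_eq_mul, mul_one]

theorem hasEnoughMinimalIdempotents_matrix : HasEnoughMinimalIdempotents (Matrix m m ℂ) := by
  classical
  intro b hb
  obtain ⟨i, j, hij⟩ : ∃ i j, b i j ≠ 0 := by
    by_contra! h
    exact hb (Matrix.ext h)
  refine ⟨Matrix.single i i (b i j)⁻¹, Matrix.single j i 1, ?_⟩
  rw [Matrix.single_mul_mul_single, mul_one, inv_mul_cancel₀ hij]
  exact isMinimalIdempotent_single i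

theorem minimalIdempotentSpan_matrix : minimalIdempotentSpan (Matrix m m ℂ) = ⊤ := by
  classical
  have hone : (1 : Matrix m m ℂ) ∈ minimalIdempotentSpan (Matrix m m ℂ) := by
    rw [← Matrix.sum_single_one]
    exact Submodule.sum_mem _ fun i _ => (isMinimalIdempotent_single i).mem_minimalIdempotentSpan
  refine (Submodule.eq_top_iff').mpr fun x => ?_
  rw [← one_mul x]
  exact isRightIdeal_minimalIdempotentSpan x 1 hone

end MatrixIdempotents

namespace AlgA

variable {c : ℕ+ → ℝ} {hc : ∀ n, 1 < c n}

/-- The matrix `x_n` of the tuple `((x_n, d_n x_n d_n⁻¹))_n`. -/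
def comp (n : ℕ+) : AlgA c hc →ₗ[ℂ] Mat n where
  toFun a := (a.1 n).1
  map_add' _ _ := rfl
  map_smul' _ _ := rfl

theorem val_apply (a : AlgA c hc) (n : ℕ+) : a.1 n = twist c n (comp n a) := by
  obtain ⟨x, hx⟩ := a.2.1 n
  change a.1 n = twist c n (a.1 n).1
  rw [hx, twist_fst]

theorem comp_mul (n : ℕ+) (a b : AlgA c hc) : comp n (a * b) = comp n a * comp n b :=
  rfl

theorem ext_comp {a b : AlgA c hc} (h : ∀ n, comp n a = comp n b) : a = b :=
  Subtype.ext (lp.ext (funext fun n => by rw [val_apply, val_apply, h]))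

instance : IsScalarTower ℂ (AlgA c hc) (AlgA c hc) :=
  ⟨fun z a b => ext_comp fun n => smul_mul_assoc z (comp n a) (comp n b)⟩

instance : SMulCommClass ℂ (AlgA c hc) (AlgA c hc) :=
  ⟨fun z a b => ext_comp fun n => (mul_smul_comm z (comp n a) (comp n b)).symm⟩

theorem comp_blockCopy_self (n : ℕ+) (x : Mat n) : comp n (blockCopy c hc n x) = x := by
  change ((lp.single ∞ n (twist c n x) : BigM) n).1 = x
  rw [lp.single_apply_self, twist_fst]

theorem comp_blockCopy_of_ne {m n : ℕ+} (h : m ≠ n) (x : Mat n) :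
    comp m (blockCopy c hc n x) = 0 := by
  change ((lp.single ∞ n (twist c n x) : BigM) m).1 = 0
  rw [lp.single_apply_ne _ _ _ h, Prod.fst_zero]

theorem eq_blockCopy {n : ℕ+} {x : Mat n} {a : AlgA c hc} (h : comp n a = x)
    (h' : ∀ m, m ≠ n → comp m a = 0) : a = blockCopy c hc n x := by
  refine ext_comp fun m => ?_
  by_cases hm : m = n
  · subst hm
    rw [comp_blockCopy_self, h]
  · rw [comp_blockCopy_of_ne hm, h' m hm]

variable (c hc) in
/-- `blockCopy` as a linear map. -/
noncomputable def blockLin (n : ℕ+) : Mat n →ₗ[ℂ] AlgA c hc where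
  toFun := blockCopy c hc n
  map_add' x y := by
    refine (eq_blockCopy ?_ fun m hm => ?_).symm
    · rw [map_add, comp_blockCopy_self, comp_blockCopy_self]
    · rw [map_add, comp_blockCopy_of_ne hm, comp_blockCopy_of_ne hm, add_zero]
  map_smul' z x := by
    refine (eq_blockCopy ?_ fun m hm => ?_).symm
    · rw [map_smul, comp_blockCopy_self, RingHom.id_apply]
    · rw [map_smul, comp_blockCopy_of_ne hm, smul_zero]

theorem blockCopy_smul {n : ℕ+} (z : ℂ) (x : Mat n) :
    blockCopy c hc n (z • x) = z • blockCopy c hc n x :=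
  (blockLin c hc n).map_smul z x

theorem blockCopy_injective (n : ℕ+) : Function.Injective (blockCopy c hc n) :=
  Function.LeftInverse.injective (comp_blockCopy_self n)

theorem blockCopy_ne_zero {n : ℕ+} {x : Mat n} (hx : x ≠ 0) : blockCopy c hc n x ≠ 0 :=
  fun h => hx (blockCopy_injective n (h.trans (blockLin c hc n).map_zero.symm))

theorem mul_blockCopy (a : AlgA c hc) {n : ℕ+} (x : Mat n) :
    a * blockCopy c hc n x = blockCopy c hc n (comp n a * x) := by
  refine eq_blockCopy ?_ fun m hm => ?_
  · rw [comp_mul, comp_blockCopy_self]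
  · rw [comp_mul, comp_blockCopy_of_ne hm, mul_zero]

theorem blockCopy_mul (a : AlgA c hc) {n : ℕ+} (x : Mat n) :
    blockCopy c hc n x * a = blockCopy c hc n (x * comp n a) := by
  refine eq_blockCopy ?_ fun m hm => ?_
  · rw [comp_mul, comp_blockCopy_self]
  · rw [comp_mul, comp_blockCopy_of_ne hm, zero_mul]

theorem blockCopy_mul_mul_blockCopy (a : AlgA c hc) {n : ℕ+} (x y : Mat n) :
    blockCopy c hc n x * a * blockCopy c hc n y = blockCopy c hc n (x * comp n a * y) := by
  rw [blockCopy_mul, mul_blockCopy, comp_blockCopy_self]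

theorem isMinimalIdempotent_blockCopy {n : ℕ+} {f : Mat n} (hf : IsMinimalIdempotent f) :
    IsMinimalIdempotent (blockCopy c hc n f) := by
  refine isMinimalIdempotent_iff.mpr ⟨blockCopy_ne_zero hf.1, ?_, fun a => ?_⟩
  · rw [mul_blockCopy, comp_blockCopy_self, hf.2.1]
  · obtain ⟨z, hz⟩ := hf.exists_mul_mul_eq_smul (comp n a)
    exact ⟨z, by rw [blockCopy_mul_mul_blockCopy, hz, blockCopy_smul]⟩

theorem exists_comp_ne_zero {a : AlgA c hc} (ha : a ≠ 0) : ∃ n, comp n a ≠ 0 := by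
  by_contra! h
  exact ha (ext_comp fun n => by rw [h, map_zero])

theorem hasEnoughMinimalIdempotents : HasEnoughMinimalIdempotents (AlgA c hc) := by
  intro b hb
  obtain ⟨n, hn⟩ := exists_comp_ne_zero hb
  obtain ⟨x, y, hxy⟩ := hasEnoughMinimalIdempotents_matrix (comp n b) hn
  refine ⟨blockCopy c hc n x, blockCopy c hc n y, ?_⟩
  rw [blockCopy_mul_mul_blockCopy]
  exact isMinimalIdempotent_blockCopy hxy

theorem exists_eq_blockCopy_of_isMinimalIdempotent {e : AlgA c hc} (he : IsMinimalIdempotent e) :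
    ∃ (n : ℕ+) (f : Mat n), IsMinimalIdempotent f ∧ e = blockCopy c hc n f := by
  obtain ⟨n, hn⟩ := exists_comp_ne_zero he.1
  have hidem : comp n e * comp n e = comp n e := by rw [← comp_mul, he.2.1]
  obtain ⟨z, hz⟩ := he.exists_mul_mul_eq_smul (blockCopy c hc n 1)
  rw [mul_blockCopy, mul_one, blockCopy_mul, hidem] at hz
  have hz1 : z = 1 := by
    have hzn := congrArg (comp n) hz
    rw [comp_blockCopy_self, map_smul] at hzn
    exact (smul_left_injective ℂ hn ((one_smul ℂ _).trans hzn)).symm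
  have heq : e = blockCopy c hc n (comp n e) := by rw [hz, hz1, one_smul]
  refine ⟨n, comp n e, isMinimalIdempotent_iff.mpr ⟨hn, hidem, fun a => ?_⟩, heq⟩
  obtain ⟨w, hw⟩ := he.exists_mul_mul_eq_smul (blockCopy c hc n a)
  refine ⟨w, ?_⟩
  simpa only [comp_mul, comp_blockCopy_self, map_smul] using congrArg (comp n) hw

theorem blockCopy_mem_minimalIdempotentSpan (n : ℕ+) (x : Mat n) :
    blockCopy c hc n x ∈ minimalIdempotentSpan (AlgA c hc) := by
  have hle : minimalIdempotentSpan (Mat n) ≤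
      (minimalIdempotentSpan (AlgA c hc)).comap (blockLin c hc n) :=
    Submodule.span_le.mpr fun f hf => (isMinimalIdempotent_blockCopy hf).mem_minimalIdempotentSpan
  exact hle (minimalIdempotentSpan_matrix (m := Fin n) ▸ Submodule.mem_top)

theorem finite_support_of_mem_minimalIdempotentSpan {a : AlgA c hc}
    (ha : a ∈ minimalIdempotentSpan (AlgA c hc)) : {n | comp n a ≠ 0}.Finite := by
  induction ha using Submodule.span_induction with
  | zero => simp
  | add a b _ _ ha hb =>
    refine (ha.union hb).subset fun n hn => ?_
    by_contra! h
    simp_all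
  | smul z a _ ha =>
    refine ha.subset fun n hn h0 => hn ?_
    rw [map_smul, h0, smul_zero]
  | mem e he =>
    obtain ⟨n, f, -, rfl⟩ := exists_eq_blockCopy_of_isMinimalIdempotent he
    exact (Set.finite_singleton n).subset fun m hm =>
      by_contra fun h => hm (comp_blockCopy_of_ne h f)

theorem incl_image_minimalIdempotentSpan :
    AlgA.incl c hc '' (minimalIdempotentSpan (AlgA c hc) : Set (AlgA c hc)) = finSupp c hc := by
  ext a
  constructor
  · rintro ⟨a, ha, rfl⟩
    refine ⟨a.2.1, (finite_support_of_mem_minimalIdempotentSpan ha).subset fun n hn h0 => hn ?_⟩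
    rw [AlgA.incl, val_apply, h0, twist_zero]
  · rintro ⟨haN, hfin⟩
    choose x hx using haN
    refine ⟨∑ n ∈ hfin.toFinset, blockCopy c hc n (x n),
      Submodule.sum_mem _ fun n _ => blockCopy_mem_minimalIdempotentSpan n _,
      lp.ext (funext fun m => ?_)⟩
    rw [AlgA.incl, val_apply, map_sum, Finset.sum_eq_single m
      (fun n _ hn => comp_blockCopy_of_ne hn.symm _), comp_blockCopy_self, hx]
    intro hm
    have ham : a m = 0 := by simpa using hm
    rw [comp_blockCopy_self, ← twist_fst (c := c) (x m), ← hx, ham, Prod.fst_zero]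

theorem mem_minimalIdempotentSpan_iff {a : AlgA c hc} :
    a ∈ minimalIdempotentSpan (AlgA c hc) ↔ {n | a.1 n ≠ 0}.Finite := by
  have hinj : Function.Injective (AlgA.incl c hc) := Subtype.val_injective
  rw [← SetLike.mem_coe, ← hinj.mem_set_image, incl_image_minimalIdempotentSpan]
  exact and_iff_right a.2.1

end AlgA

section Radical

variable {c : ℕ+ → ℝ} {hc : ∀ n, 1 < c n}

theorem inv_mem_algN {w : BigMˣ} (hw : w.1 ∈ algN c hc) : (w⁻¹).1 ∈ algN c hc := by
  intro n
  obtain ⟨x, hx⟩ := hw n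
  have hinv : (w⁻¹).1 n * w.1 n = 1 := units_inv_apply_mul w n
  have hinv' : w.1 n * (w⁻¹).1 n = 1 := units_inv_apply_mul w⁻¹ n
  refine ⟨((w⁻¹).1 n).1, (left_inv_eq_right_inv ?_ hinv').symm⟩
  have hfst : ((w⁻¹).1 n).1 * x = 1 := by
    rw [hx] at hinv
    exact congrArg Prod.fst hinv
  rw [hx, ← twist_mul hc, hfst, twist_one hc]

theorem one_mem_algN : (1 : BigM) ∈ algN c hc :=
  fun n => ⟨1, (twist_one hc n).symm⟩

theorem tailIdempotent_mem_algN (S : Finset ℕ+) : tailIdempotent _ S ∈ algN c hc := by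
  intro n
  by_cases hn : n ∈ S
  · exact ⟨0, by rw [tailIdempotent_apply, if_pos hn, twist_zero]⟩
  · exact ⟨1, by rw [tailIdempotent_apply, if_neg hn, twist_one hc]⟩

theorem mul_mem_algA_of_commute {a w : BigM} (ha : a ∈ algA c hc) (hw : w ∈ algN c hc)
    (hcomm : Commute w a) : w * a ∈ algA c hc := by
  obtain ⟨haN, hlim⟩ := ha
  refine ⟨mul_mem hw haN, squeeze_zero (fun k => by positivity) (fun k => ?_)
    (by simpa using hlim.const_mul ‖w‖)⟩
  have hr : w * a * uElt c hc k - w * a = w * (a * uElt c hc k - a) := by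
    rw [mul_sub, mul_assoc]
  have hl : uElt c hc k * (w * a) - w * a = (uElt c hc k * a - a) * w := by
    rw [hcomm.eq, sub_mul, mul_assoc]
  rw [hr, hl, mul_add, mul_comm ‖w‖ ‖uElt c hc k * a - a‖]
  exact add_le_add (norm_mul_le _ _) (norm_mul_le _ _)

theorem tendsto_norm_mul_uElt_sub {a : BigM} (ha : a ∈ algA c hc) :
    Tendsto (fun k => ‖a * uElt c hc k - a‖) atTop (𝓝 0) :=
  squeeze_zero (fun _ => norm_nonneg _) (fun _ => le_add_of_nonneg_right (norm_nonneg _)) ha.2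

theorem norm_uElt_le (k : ℕ+) : ‖uElt c hc k‖ ≤ 1 :=
  lp.norm_le_of_forall_le zero_le_one fun n => norm_twist_uMat_le hc n k

theorem tendsto_norm_apply_snd {r : ℝ} (hr : 1 < r) (hrc : ∀ n, r ≤ c n) {a : BigM}
    (ha : a ∈ algA c hc) : Tendsto (fun n => ‖(a n).2‖) atTop (𝓝 0) := by
  refine NormedAddGroup.tendsto_nhds_zero.mpr fun ε hε => ?_
  obtain ⟨k, hk⟩ :=
    ((tendsto_norm_mul_uElt_sub ha).eventually_lt_const (half_pos hε)).exists
  have hlim : Tendsto (fun n => ‖a‖ * ‖(twist c n (uMat n k)).2‖) atTop (𝓝 0) := by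
    simpa using (tendsto_norm_twist_uMat_snd hc hr hrc k).const_mul ‖a‖
  filter_upwards [hlim.eventually_lt_const (half_pos hε)] with n hn
  have happly (b : BigM) : ‖(b n).2‖ ≤ ‖b‖ :=
    (norm_snd_le (b n)).trans (lp.norm_apply_le_norm ENNReal.top_ne_zero b n)
  have hsub : (a n).2 = (a n).2 * (twist c n (uMat n k)).2 - ((a * uElt c hc k - a) n).2 :=
    (sub_sub_cancel _ _).symm
  rw [norm_norm]
  calc ‖(a n).2‖
      ≤ ‖(a n).2 * (twist c n (uMat n k)).2‖ + ‖((a * uElt c hc k - a) n).2‖ := by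
        conv_lhs => rw [hsub]
        exact norm_sub_le _ _
    _ ≤ ‖a‖ * ‖(twist c n (uMat n k)).2‖ + ‖a * uElt c hc k - a‖ :=
        add_le_add ((norm_mul_le _ _).trans
          (mul_le_mul_of_nonneg_right (happly a) (norm_nonneg _))) (happly _)
    _ < ε := by linarith

/-- The tuples of pairs `(x, 0)` with `x` upper triangular. -/
def upperTuples : Set BigM :=
  {t | ∀ n : ℕ+, (t n).1 ∈ upperBand ℂ n 0 ∧ (t n).2 = 0}

theorem exists_add_mem_upperTuples {r : ℝ} (hr : 1 < r) (hrc : ∀ n, r ≤ c n) {a : BigM}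
    (ha : a ∈ algA c hc) :
    ∃ t ∈ upperTuples, ∃ s : BigM, Tendsto (fun n => ‖s n‖) cofinite (𝓝 0) ∧ t + s = a := by
  have hlim := tendsto_norm_apply_snd hr hrc ha
  have hlower (n : ℕ+) : ‖lowerPart (a n).1‖ ≤ ‖(a n).2‖ / (r - 1) := by
    obtain ⟨x, hx⟩ := ha.1 n
    rw [hx, twist_fst]
    exact (norm_lowerPart_le hc x).trans
      (div_le_div_of_nonneg_left (norm_nonneg _) (sub_pos.mpr hr) (sub_le_sub_right (hrc n) 1))
  have hs : Tendsto (fun n => ‖(lowerPart (a n).1, (a n).2)‖) atTop (𝓝 0) := by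
    have hmax := (hlim.div_const (r - 1)).max hlim
    rw [zero_div, max_self] at hmax
    exact squeeze_zero (fun n => norm_nonneg _) (fun n => max_le_max_right _ (hlower n)) hmax
  have hs' := hs.mono_left (cofinite_le_atTop ℕ+)
  let s : BigM := ⟨fun n => (lowerPart (a n).1, (a n).2),
    memℓp_infty hs'.bddAbove_range_of_cofinite⟩
  exact ⟨a - s, fun n => ⟨sub_lowerPart_mem_upperBand _, sub_self _⟩, s, hs', sub_add_cancel a s⟩

theorem isNilpotent_mul_uElt {b : BigM} {S : Finset ℕ+} {k : ℕ+}
    (hb : b ∈ upperTuples) (hS : ∀ n ∉ S, k ≤ n) (hbS : ∀ n ∈ S, b n = 0) :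
    IsNilpotent (b * uElt c hc k) := by
  refine ⟨k, lp.ext (funext fun n => ?_)⟩
  rw [lp.infty_coeFn_pow, Pi.pow_apply, lp.infty_coeFn_mul, Pi.mul_apply, lp.coeFn_zero,
    Pi.zero_apply]
  by_cases hn : n ∈ S
  · rw [hbS n hn, zero_mul, zero_pow k.ne_zero]
  · have hmem : (b n).1 * uMat n k ∈ upperBand ℂ n ⌈(n : ℚ) / (k : ℚ)⌉₊ := by
      simpa using mul_mem_upperBand (hb n).1 (uMat_mem_upperBand (hS n hn))
    refine Prod.ext (pow_eq_zero_of_mem_upperBand hmem (le_mul_ceil_div n k)) ?_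
    rw [Prod.pow_snd, Prod.snd_mul, (hb n).2, zero_mul, zero_pow k.ne_zero, Prod.snd_zero]

theorem tailIdempotent_mul_mem_upperTuples {t : BigM} (ht : t ∈ upperTuples) (S : Finset ℕ+) :
    tailIdempotent _ S * t ∈ upperTuples := by
  intro n
  rw [tailIdempotent_mul_apply]
  split_ifs
  · exact ⟨zero_mem _, rfl⟩
  · exact ht n

theorem inv_mul_mem_upperTuples {v : BigMˣ} (hv : ∀ n : ℕ+, (v.1 n).1 ∈ upperBand ℂ n 0) {t : BigM}
    (ht : t ∈ upperTuples) : (v⁻¹).1 * t ∈ upperTuples := fun n =>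
  ⟨mul_mem_upperBand (mem_upperBand_zero_of_mul_eq_one (hv n)
      (congrArg Prod.fst (units_inv_apply_mul v n))) (ht n).1,
    (congrArg (((v⁻¹).1 n).2 * ·) (ht n).2).trans (mul_zero _)⟩

theorem isUnit_one_sub_tailIdempotent_mul_of_mem_upperTuples {t : BigM} (ht : t ∈ upperTuples)
    {S : Finset ℕ+} {k : ℕ+} (hS : ∀ n ∉ S, k ≤ n)
    (hk : ‖tailIdempotent _ S * t - tailIdempotent _ S * t * uElt c hc k‖ < 1) :
    IsUnit (1 - tailIdempotent _ S * t) := by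
  set T := tailIdempotent _ S * t with hT
  have hTup : T ∈ upperTuples := tailIdempotent_mul_mem_upperTuples ht S
  set v := Units.oneSub (T - T * uElt c hc k) hk with hv
  have hvup (n : ℕ+) : (v.1 n).1 ∈ upperBand ℂ n 0 :=
    sub_mem one_mem_upperBand (sub_mem (hTup n).1
      (mul_mem_upperBand (hTup n).1 (uMat_mem_upperBand_zero n k)))
  have hsplit : 1 - T = v - T * uElt c hc k := by
    rw [hv, Units.val_oneSub]; abel
  rw [hsplit]
  refine isUnit_sub_of_isNilpotent v ?_
  rw [← mul_assoc]
  refine isNilpotent_mul_uElt (inv_mul_mem_upperTuples hvup hTup) hS fun n hn => ?_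
  rw [lp.infty_coeFn_mul, Pi.mul_apply, hT, tailIdempotent_mul_apply, if_pos hn, mul_zero]

theorem exists_isUnit_one_sub_tailIdempotent_mul {r : ℝ} (hr : 1 < r) (hrc : ∀ n, r ≤ c n)
    {a : BigM} (ha : a ∈ algA c hc) : ∃ S, IsUnit (1 - tailIdempotent _ S * a) := by
  obtain ⟨t, ht, s, hs, rfl⟩ := exists_add_mem_upperTuples hr hrc ha
  obtain ⟨k, hk⟩ := ((tendsto_norm_mul_uElt_sub ha).eventually_lt_const one_half_pos).exists
  obtain ⟨S, hPs, hSk⟩ := (((tendsto_tailIdempotent_mul hs).norm.eventually_lt_const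
    (norm_zero.trans_lt (by norm_num : (0 : ℝ) < 1 / 4))).and
    (eventually_ge_atTop (Finset.Iio k))).exists
  have hS (n : ℕ+) (hn : n ∉ S) : k ≤ n := not_lt.mp fun h => hn (hSk (Finset.mem_Iio.mpr h))
  refine exists_isUnit_one_sub_tailIdempotent_mul_add hs
    (isUnit_one_sub_tailIdempotent_mul_of_mem_upperTuples ht hS (c := c) (hc := hc) ?_)
  set P := tailIdempotent (fun n : ℕ+ => Mat n × Mat n) S
  set U := uElt c hc k
  have hPa : ‖P * ((t + s) * U - (t + s))‖ < 1 / 2 :=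
    (norm_mul_le _ _).trans_lt ((mul_le_of_le_one_left (norm_nonneg _)
      (norm_tailIdempotent_le S)).trans_lt hk)
  have hPsU : ‖P * s * U‖ < 1 / 4 :=
    (norm_mul_le _ _).trans_lt ((mul_le_of_le_one_right (norm_nonneg _)
      (norm_uElt_le k)).trans_lt hPs)
  calc ‖P * t - P * t * U‖
      = ‖P * s * U - P * s - P * ((t + s) * U - (t + s))‖ := by congr 1; noncomm_ring
    _ ≤ ‖P * s * U‖ + ‖P * s‖ + ‖P * ((t + s) * U - (t + s))‖ :=
        (norm_sub_le _ _).trans (add_le_add_left (norm_sub_le _ _) _)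
    _ < 1 := by linarith

theorem isRadicalModulo_minimalIdempotentSpan {r : ℝ} (hr : 1 < r) (hrc : ∀ n, r ≤ c n) :
    IsRadicalModulo (minimalIdempotentSpan (AlgA c hc)) := by
  intro u
  obtain ⟨S, w, hw⟩ := exists_isUnit_one_sub_tailIdempotent_mul hr hrc u.2
  set P := tailIdempotent (fun n : ℕ+ => Mat n × Mat n) S
  have hPu : Commute P u.1 := tailIdempotent_commute S u.1
  have hcomm : Commute ((w⁻¹).1 * P) u.1 := by
    refine Commute.mul_left (Commute.units_inv_left ?_) hPu
    rw [hw]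
    exact (Commute.one_left _).sub_left (hPu.mul_left (Commute.refl _))
  have hwN : (w⁻¹).1 ∈ algN c hc := inv_mem_algN
    (hw ▸ sub_mem one_mem_algN (mul_mem (tailIdempotent_mem_algN S) u.2.1))
  let q : AlgA c hc := ⟨(w⁻¹).1 * P * u.1,
    mul_mem_algA_of_commute u.2 (mul_mem hwN (tailIdempotent_mem_algN S)) hcomm⟩
  have hzero : P * (q - u - u * q).1 = 0 :=
    mul_quasiInverse_sub_eq_zero (isIdempotentElem_tailIdempotent S) (tailIdempotent_commute S) hw
  have hmem : q - u - u * q ∈ minimalIdempotentSpan (AlgA c hc) :=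
    AlgA.mem_minimalIdempotentSpan_iff.mpr (finite_support_of_tailIdempotent_mul_eq_zero hzero)
  have hqu : q * u = u * q := Subtype.ext (hcomm.mul_left (Commute.refl _)).eq
  exact ⟨q, hmem, hqu ▸ hmem⟩

end Radical

theorem mainTheorem11_general (c : ℕ+ → ℝ) (hc : ∀ n, 1 < c n) {r : ℝ} (hr : 1 < r)
    (hrc : ∀ n, r ≤ c n) :
    (∀ J : Submodule ℂ (AlgA c hc), IsMaximalModularRightIdeal J ↔
      ∃ e : AlgA c hc, IsMinimalIdempotent e ∧
        (∃ (n : ℕ+) (f : Mat n), IsMinimalIdempotent f ∧ e = blockCopy c hc n f) ∧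
        (J : Set (AlgA c hc)) = Set.range fun a => a - e * a) ∧
    (∀ J : Submodule ℂ (AlgA c hc), IsMaximalModularLeftIdeal J ↔
      ∃ e : AlgA c hc, IsMinimalIdempotent e ∧
        (∃ (n : ℕ+) (f : Mat n), IsMinimalIdempotent f ∧ e = blockCopy c hc n f) ∧
        (J : Set (AlgA c hc)) = Set.range fun a => a - a * e) ∧
    AlgA.incl c hc '' (leftSocle (AlgA c hc) : Set (AlgA c hc)) = finSupp c hc ∧
    AlgA.incl c hc '' (rightSocle (AlgA c hc) : Set (AlgA c hc)) = finSupp c hc := by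
  have hmin : HasEnoughMinimalIdempotents (AlgA c hc) := AlgA.hasEnoughMinimalIdempotents
  have hrad : IsRadicalModulo (minimalIdempotentSpan (AlgA c hc)) :=
    isRadicalModulo_minimalIdempotentSpan hr hrc
  have hblock {e : AlgA c hc} (he : IsMinimalIdempotent e) (p : Prop) :
      p ↔ (∃ (n : ℕ+) (f : Mat n), IsMinimalIdempotent f ∧ e = blockCopy c hc n f) ∧ p :=
    (and_iff_right (AlgA.exists_eq_blockCopy_of_isMinimalIdempotent he)).symm
  refine ⟨fun J => ?_, fun J => ?_, ?_, ?_⟩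
  · rw [isMaximalModularRightIdeal_iff hmin hrad]
    exact exists_congr fun e => and_congr_right fun he => hblock he _
  · rw [isMaximalModularLeftIdeal_iff hmin hrad]
    exact exists_congr fun e => and_congr_right fun he => hblock he _
  · rw [leftSocle_eq_minimalIdempotentSpan hmin, AlgA.incl_image_minimalIdempotentSpan]
  · rw [rightSocle_eq_minimalIdempotentSpan hmin, AlgA.incl_image_minimalIdempotentSpan]

theorem mainTheorem11 (c : ℕ+ → ℝ) (hc : ∀ n, 1 < c n) (hmono : Monotone c)
    (hunb : ¬ BddAbove (Set.range c)) :
    (∀ J : Submodule ℂ (AlgA c hc), IsMaximalModularRightIdeal J ↔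
      ∃ e : AlgA c hc, IsMinimalIdempotent e ∧
        (∃ (n : ℕ+) (f : Mat n), IsMinimalIdempotent f ∧ e = blockCopy c hc n f) ∧
        (J : Set (AlgA c hc)) = Set.range fun a => a - e * a) ∧
    (∀ J : Submodule ℂ (AlgA c hc), IsMaximalModularLeftIdeal J ↔
      ∃ e : AlgA c hc, IsMinimalIdempotent e ∧
        (∃ (n : ℕ+) (f : Mat n), IsMinimalIdempotent f ∧ e = blockCopy c hc n f) ∧
        (J : Set (AlgA c hc)) = Set.range fun a => a - a * e) ∧
    AlgA.incl c hc '' (leftSocle (AlgA c hc) : Set (AlgA c hc)) = finSupp c hc ∧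
    AlgA.incl c hc '' (rightSocle (AlgA c hc) : Set (AlgA c hc)) = finSupp c hc :=
  mainTheorem11_general c hc (hc 1) fun _ => hmono one_le
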